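/- Let $R$ be an associative unital ring; modules are left modules and $\mathcal C(R)$ is the category of $\mathbb Z$-indexed chain complexes of $R$-modules ($R$-complexes). A short exact sequence $0\to L\to M\to N\to 0$ of $R$-modules is pure if it stays exact under $\mathrm{Hom}_R(A,-)$ for every finitely presented $R$-module $A$; a short exact sequence of $R$-complexes is pure if it stays exact under $\mathrm{Hom}_{\mathcal C(R)}(A,-)$ for every bounded complex $A$ of finitely presented $R$-modules. A subcomplex $P\subseteq M$ is pure if $0\to P\to M\to M/P\to 0$ is pure. An $R$-complex $M$ is pure-acyclic if it is acyclic and, with $Z_i(M)=\ker\partial_i^M$, the sequence $0\to Z_i(M)\to M_i\to Z_{i-1}(M)\to 0$ is pure for every $i\in\mathbb Z$; it is contractible if its identity morphism is null-homotopic; it is pure-minimal if the zero complex is its only pure-acyclic pure subcomplex. The ring $R$ is left perfect (respectively, semi-perfect) if every (respectively, every finitely generated) $R$-module has a projective cover. Let $M$ be an $R$-complex and assume that one of the following holds. (a) $R$ is left noetherian and $M$ is a complex of injective $R$-modules. (b) $R$ is left perfect and $M$ is a complex of projective $R$-modules. (c) $R$ is semi-perfect and $M$ is a complex of finitely generated projective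 $R$-modules. (d) $R$ is left noetherian and $M$ is a complex of finitely generated projective $R$-modules. Then $M$ has a pure-acyclic pure subcomplex $P$ such that $M/P$ is pure-minimal. Moreover, for every such $P$ the canonical exact sequence $0\to P\to M\to M/P\to 0$ splits in $\mathcal C(R)$ and yields an isomorphism $M\cong P\oplus (M/P)$ compatible with the canonical maps $P\to M$ and $M\to M/P$; here $P$ is contractible and $M/P$ is pure-minimal. -/

import Mathlib

open CategoryTheory CategoryTheory.Limits

universe u

namespace PureMinimality

/-- The category `C(R)` of (unbounded, homologically indexed) chain complexes of left
`R`-modules. -/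
abbrev RComplex (R : Type u) [Ring R] := ChainComplex (ModuleCat.{u} R) ℤ

section Purity

variable {R : Type u} [Ring R]

/-- A short exact sequence `0 → L → M → N → 0` of `R`-modules is pure if
`0 → Hom(A, L) → Hom(A, M) → Hom(A, N) → 0` is exact for every finitely presented
`R`-module `A`. -/
def IsPureModuleSeq (S : ShortComplex (ModuleCat.{u} R)) : Prop :=
  S.ShortExact ∧
    ∀ A : ModuleCat.{u} R, Module.FinitePresentation R A →
      Function.Injective (fun h : A ⟶ S.X₁ => h ≫ S.f) ∧
      Function.Exact (fun h : A ⟶ S.X₁ => h ≫ S.f) (fun h : A ⟶ S.X₂ => h ≫ S.g) ∧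
      Function.Surjective (fun h : A ⟶ S.X₂ => h ≫ S.g)

/-- `A` is a bounded complex of finitely presented `R`-modules. -/
def IsBoundedFinPres (A : RComplex R) : Prop :=
  (∃ a b : ℤ, ∀ i : ℤ, i < a ∨ b < i → IsZero (A.X i)) ∧
    ∀ i : ℤ, Module.FinitePresentation R (A.X i)

/-- A short exact sequence `0 → L → M → N → 0` of `R`-complexes is pure if
`0 → C(R)(A, L) → C(R)(A, M) → C(R)(A, N) → 0` is exact for every bounded complex `A` of
finitely presented `R`-modules. -/
def IsPureComplexSeq (S : ShortComplex (RComplex R)) : Prop :=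
  S.ShortExact ∧
    ∀ A : RComplex R, IsBoundedFinPres A →
      Function.Injective (fun h : A ⟶ S.X₁ => h ≫ S.f) ∧
      Function.Exact (fun h : A ⟶ S.X₁ => h ≫ S.f) (fun h : A ⟶ S.X₂ => h ≫ S.g) ∧
      Function.Surjective (fun h : A ⟶ S.X₂ => h ≫ S.g)

/-- The sequence `Z_i(M) → M_i → Z_{i-1}(M)`: the inclusion of the cycles followed by the
map induced by the differential. -/
noncomputable def cycleSeq (M : RComplex R) (i : ℤ) : ShortComplex (ModuleCat.{u} R) :=
  ShortComplex.mk (M.iCycles i) (M.toCycles i (i - 1)) (by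
    rw [← cancel_mono (M.iCycles (i - 1))]
    simp)

/-- `M` is pure-acyclic: it is acyclic and the sequences
`0 → Z_i(M) → M_i → Z_{i-1}(M) → 0` are pure. -/
def IsPureAcyclic (M : RComplex R) : Prop :=
  M.Acyclic ∧ ∀ i : ℤ, IsPureModuleSeq (cycleSeq M i)

/-- `M` is contractible: its identity is null-homotopic. -/
def IsContractible (M : RComplex R) : Prop :=
  Nonempty (Homotopy (𝟙 M) 0)

end Purity

section Subcomplexes

variable {R : Type u} [Ring R]

/-- A subcomplex of `M`: a family of submodules stable under the differential. -/
@[ext]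
structure Subcomplex (M : RComplex R) where
  carrier : ∀ i : ℤ, Submodule R (M.X i)
  d_mem : ∀ (i j : ℤ) (x : M.X i), x ∈ carrier i → (M.d i j).hom x ∈ carrier j

namespace Subcomplex

variable {M : RComplex R} (P : Subcomplex M)

/-- A subcomplex, as a complex in its own right. -/
def toComplex : RComplex R where
  X i := ModuleCat.of R (P.carrier i)
  d i j := ModuleCat.ofHom ((M.d i j).hom.restrict (P.d_mem i j))
  shape i j hij := by
    ext x
    simp [LinearMap.restrict_apply, M.shape i j hij]
  d_comp_d' i j k _ _ := by
    ext x
    have h := congrArg (fun f => f.hom (x : M.X i)) (M.d_comp_d i j k)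
    exact h

/-- The quotient complex `M/P`. -/
def quotient : RComplex R where
  X i := ModuleCat.of R (M.X i ⧸ P.carrier i)
  d i j := ModuleCat.ofHom
    ((P.carrier i).mapQ (P.carrier j) (M.d i j).hom (P.d_mem i j))
  shape i j hij := by
    ext x
    simp [M.shape i j hij]
  d_comp_d' i j k _ _ := by
    ext x
    have h := congrArg (fun f => f.hom x) (M.d_comp_d i j k)
    exact congrArg (P.carrier k).mkQ h

/-- The inclusion `P → M`. -/
def ι : P.toComplex ⟶ M where
  f i := ModuleCat.ofHom (P.carrier i).subtype
  comm' i j _ := by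
    ext x
    rfl

/-- The canonical map `M → M/P`. -/
def π : M ⟶ P.quotient where
  f i := ModuleCat.ofHom (P.carrier i).mkQ
  comm' i j _ := by
    ext x
    rfl

/-- The canonical sequence `P → M → M/P` in `C(R)`. -/
def seq : ShortComplex (RComplex R) :=
  ShortComplex.mk P.ι P.π (by
    ext i x
    exact (Submodule.Quotient.mk_eq_zero (P.carrier i)).2 x.2)

/-- `P` is a pure subcomplex of `M`. -/
def IsPure : Prop := IsPureComplexSeq P.seq

end Subcomplex

/-- `M` is pure-minimal: the zero complex is its only pure-acyclic pure subcomplex. -/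
def IsPureMinimal (M : RComplex R) : Prop :=
  ∀ P : Subcomplex M, P.IsPure → IsPureAcyclic P.toComplex → ∀ i : ℤ, P.carrier i = ⊥

end Subcomplexes

section Rings

/-- The `R`-module `N` has a projective cover: a surjection from a projective module whose
kernel is superfluous. -/
def HasProjectiveCover (R : Type u) [Ring R] (N : ModuleCat.{u} R) : Prop :=
  ∃ (Q : ModuleCat.{u} R) (p : Q →ₗ[R] N), Module.Projective R Q ∧ Function.Surjective p ∧
    ∀ U : Submodule R Q, U ⊔ LinearMap.ker p = ⊤ → U = ⊤

/-- `R` is left perfect: every left `R`-module has a projective cover. -/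
def IsLeftPerfect (R : Type u) [Ring R] : Prop :=
  ∀ N : ModuleCat.{u} R, HasProjectiveCover R N

/-- `R` is semi-perfect: every finitely generated left `R`-module has a projective cover. -/
def IsSemiPerfect (R : Type u) [Ring R] : Prop :=
  ∀ N : ModuleCat.{u} R, Module.Finite R N → HasProjectiveCover R N

end Rings

end PureMinimality

/-! Existence is Zorn's lemma for any ring. Pure-acyclic pure subcomplexes are exactly the
degreewise pure `P` with Hom(A, P) acyclic for every finitely presented A
(`isDegreewisePureAcyclic_iff`), a class closed under directed unions and under preimages along M →
M/P. A maximal member therefore has pure-minimal quotient.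

Splitting uses one property of the modules M_i, `PureEpiSplits`: every pure epimorphism out of M_i
has a section. In (a) the kernel is again injective; in (b) and (c) a projective cover of the target
shows that it is projective; in (d) the target is finitely presented. Hence each P_i is a summand of
M_i and inherits the property, the maps P_i → Z_{i-1}(P) split, and P is contractible. Composing a
contraction with the degreewise retractions gives a retraction of complexes. -/

namespace PureMinimality

/-! ### Pure epimorphisms of modules and when they split -/

section Modules

variable {R : Type u} [Ring R]

/-- A linear map `p : X → Y` is a pure epimorphism if every map from a finitely presented module
to `Y` lifts along `p`. -/
def PureEpi {X Y : Type u} [AddCommGroup X] [Module R X] [AddCommGroup Y] [Module R Y]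
    (p : X →ₗ[R] Y) : Prop :=
  ∀ (A : Type u) [AddCommGroup A] [Module R A], Module.FinitePresentation R A →
    ∀ f : A →ₗ[R] Y, ∃ g : A →ₗ[R] X, p ∘ₗ g = f

/-- Every pure epimorphism out of `X` splits. -/
def PureEpiSplits (R : Type u) [Ring R] (X : Type u) [AddCommGroup X] [Module R X] : Prop :=
  ∀ (Y : Type u) [AddCommGroup Y] [Module R Y] (p : X →ₗ[R] Y), PureEpi p →
    ∃ s : Y →ₗ[R] X, p ∘ₗ s = LinearMap.id

variable {X Y Z : Type u} [AddCommGroup X] [Module R X] [AddCommGroup Y] [Module R Y]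
  [AddCommGroup Z] [Module R Z]

theorem PureEpi.surjective {p : X →ₗ[R] Y} (hp : PureEpi p) : Function.Surjective p := by
  intro y
  obtain ⟨g, hg⟩ := hp R inferInstance (LinearMap.toSpanSingleton R Y y)
  exact ⟨g 1, by simpa using LinearMap.congr_fun hg 1⟩

theorem PureEpi.comp {q : Y →ₗ[R] Z} {p : X →ₗ[R] Y} (hq : PureEpi q) (hp : PureEpi p) :
    PureEpi (q ∘ₗ p) := by
  intro A _ _ hA f
  obtain ⟨g, rfl⟩ := hq A hA f
  obtain ⟨h, rfl⟩ := hp A hA g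
  exact ⟨h, rfl⟩

theorem PureEpi.of_section {p : X →ₗ[R] Y} {s : Y →ₗ[R] X} (h : p ∘ₗ s = LinearMap.id) :
    PureEpi p := by
  intro A _ _ _ f
  exact ⟨s ∘ₗ f, by rw [← LinearMap.comp_assoc, h, LinearMap.id_comp]⟩

theorem PureEpiSplits.of_retract (hX : PureEpiSplits R X) {r : X →ₗ[R] Y} {s : Y →ₗ[R] X}
    (h : r ∘ₗ s = LinearMap.id) : PureEpiSplits R Y := by
  intro Z _ _ p hp
  obtain ⟨t, ht⟩ := hX Z (p ∘ₗ r) (hp.comp (PureEpi.of_section h))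
  exact ⟨r ∘ₗ t, by rw [← LinearMap.comp_assoc, ht]⟩

/-- A pure submodule of a module whose pure epimorphisms split is a direct summand. -/
theorem PureEpiSplits.exists_retraction (hX : PureEpiSplits R X) {N : Submodule R X}
    (hN : PureEpi N.mkQ) : ∃ r : X →ₗ[R] N, r ∘ₗ N.subtype = LinearMap.id := by
  obtain ⟨s, hs⟩ := hX _ N.mkQ hN
  have hmem (x : X) : (LinearMap.id - s ∘ₗ N.mkQ : X →ₗ[R] X) x ∈ N := by
    rw [← Submodule.Quotient.mk_eq_zero]
    have h : N.mkQ (s (N.mkQ x)) = N.mkQ x := LinearMap.congr_fun hs (N.mkQ x)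
    change N.mkQ (x - s (N.mkQ x)) = 0
    rw [map_sub, h, sub_self]
  refine ⟨LinearMap.codRestrict N _ hmem, ?_⟩
  ext x
  have h : N.mkQ x = 0 := (Submodule.Quotient.mk_eq_zero N).2 x.2
  change (x : X) - s (N.mkQ x) = x
  rw [h, map_zero, sub_zero]

/-- The kernel is injective by Baer's criterion: extend f : I → ker p to g : R → X; then p ∘ g
factors through the finitely presented R/I, and subtracting a lift of that map moves g into ker p
without changing it on I. -/
theorem pureEpiSplits_of_injective [IsNoetherianRing R] (hX : Module.Injective R X) :
    PureEpiSplits R X := by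
  intro Y _ _ p hp
  have hb : Module.Baer R (LinearMap.ker p) := by
    intro I f
    obtain ⟨g, hg⟩ := Module.Baer.of_injective hX I ((LinearMap.ker p).subtype ∘ₗ f)
    obtain ⟨l, hl⟩ := hp (R ⧸ I) (Module.finitePresentation_of_finite R _)
      (I.liftQ (p ∘ₗ g) fun x hx => by
        have h := hg x hx
        simp only [LinearMap.mem_ker, LinearMap.comp_apply, h]
        exact (f ⟨x, hx⟩).2)
    refine ⟨(g - l ∘ₗ I.mkQ).codRestrict _ fun x => ?_, fun x hx => ?_⟩
    · have h : p (l (I.mkQ x)) = p (g x) := LinearMap.congr_fun hl (I.mkQ x)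
      change p (g x - l (I.mkQ x)) = 0
      rw [map_sub, h, sub_self]
    · ext
      have h0 : I.mkQ x = 0 := by simpa using hx
      have h := hg x hx
      simp only [LinearMap.codRestrict_apply, LinearMap.sub_apply, LinearMap.comp_apply, h0]
      simpa using h
  have hinj := hb.injective
  obtain ⟨r, hr⟩ := hinj.out (LinearMap.ker p).subtype Subtype.val_injective LinearMap.id
  have hk : LinearMap.ker p ≤
      LinearMap.ker (LinearMap.id - (LinearMap.ker p).subtype ∘ₗ r : X →ₗ[R] X) := by
    intro x hx
    have := hr ⟨x, hx⟩
    simp_all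
  let e := p.quotKerEquivOfSurjective hp.surjective
  refine ⟨(LinearMap.ker p).liftQ _ hk ∘ₗ e.symm.toLinearMap, ?_⟩
  ext y
  obtain ⟨x, rfl⟩ := hp.surjective y
  have : e.symm (p x) = (LinearMap.ker p).mkQ x := by
    rw [LinearEquiv.symm_apply_eq]; rfl
  simp [this]

theorem pureEpiSplits_of_finite [IsNoetherianRing R] [Module.Finite R X] :
    PureEpiSplits R X := by
  intro Y _ _ p hp
  have := Module.Finite.of_surjective p hp.surjective
  exact hp Y (Module.finitePresentation_of_finite R _) LinearMap.id

/-- A finite family of dual basis elements suffices for a single element. -/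
theorem exists_factorization_fixing [Module.Projective R X] (x : X) :
    ∃ (s : Finset X) (a : X →ₗ[R] (s → R)) (b : (s → R) →ₗ[R] X), b (a x) = x := by
  obtain ⟨t, ht⟩ := Module.projective_def'.1 ‹Module.Projective R X›
  refine ⟨(t x).support, LinearMap.pi fun i => Finsupp.lapply i.1 ∘ₗ t,
    Fintype.linearCombination R fun i => i.1, ?_⟩
  have h := LinearMap.congr_fun ht x
  simp only [LinearMap.comp_apply, Finsupp.linearCombination_apply, Finsupp.sum,
    LinearMap.id_apply, id] at h
  conv_rhs => rw [← h]
  rw [Fintype.linearCombination_apply]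
  exact Finset.sum_coe_sort (t x).support fun i => t x i • i

/-- Every element of the kernel of a pure epimorphism from a projective module is fixed by an
endomorphism with image in that kernel. -/
theorem PureEpi.exists_fixing [Module.Projective R X] {p : X →ₗ[R] Y} (hp : PureEpi p) {x : X}
    (hx : p x = 0) : ∃ t : X →ₗ[R] X, p ∘ₗ t = 0 ∧ t x = x := by
  obtain ⟨s, a, b, hab⟩ := exists_factorization_fixing (R := R) x
  -- The quotient by a x is finitely presented and p ∘ b factors through it; its lift l vanishes on
  -- a x, so b - l corrected this way still sends a x to x.
  let S := Submodule.span R {a x}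
  have hS : Module.FinitePresentation R ((s → R) ⧸ S) :=
    Module.finitePresentation_of_surjective S.mkQ S.mkQ_surjective
      (by rw [S.ker_mkQ]; exact Submodule.fg_span_singleton _)
  obtain ⟨l, hl⟩ := hp _ hS (S.liftQ (p ∘ₗ b) (by
    rw [Submodule.span_singleton_le_iff_mem]
    simp [hab, hx]))
  refine ⟨(b - l ∘ₗ S.mkQ) ∘ₗ a, ?_, ?_⟩
  · ext y
    have h : p (l (S.mkQ (a y))) = p (b (a y)) := LinearMap.congr_fun hl (S.mkQ (a y))
    change p (b (a y) - l (S.mkQ (a y))) = 0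
    rw [map_sub, h, sub_self]
  · have : S.mkQ (a x) = 0 :=
      (Submodule.Quotient.mk_eq_zero S).2 (Submodule.mem_span_singleton_self _)
    simp only [LinearMap.comp_apply, LinearMap.sub_apply, this]
    simpa using hab

/-- A pure epimorphism from a projective module with superfluous kernel is injective. -/
theorem PureEpi.injective_of_superfluous [Module.Projective R X] {p : X →ₗ[R] Y}
    (hp : PureEpi p) (hs : ∀ U : Submodule R X, U ⊔ LinearMap.ker p = ⊤ → U = ⊤) :
    Function.Injective p := by
  rw [injective_iff_map_eq_zero]
  intro x hx
  obtain ⟨t, ht, htx⟩ := hp.exists_fixing hx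
  have htp (y : X) : p (t y) = 0 := LinearMap.congr_fun ht y
  -- Superfluity is used twice: for id - t, and then for a section c of it. Surjectivity of c makes
  -- id - t injective, and id - t kills x.
  have hsurj : LinearMap.range (LinearMap.id - t) = ⊤ := by
    refine hs _ (eq_top_iff.2 fun y _ => ?_)
    rw [← sub_add_cancel y (t y)]
    exact Submodule.add_mem_sup ⟨y, rfl⟩ (htp y)
  obtain ⟨c, hc⟩ := Module.projective_lifting_property (LinearMap.id - t) LinearMap.id
    (LinearMap.range_eq_top.1 hsurj)
  have hc' (y : X) : c y - t (c y) = y := LinearMap.congr_fun hc y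
  have hr : LinearMap.range c = ⊤ := by
    refine hs _ (eq_top_iff.2 fun y _ => ?_)
    have h : y = c (y - t y) + (y - c (y - t y)) := by abel
    rw [h]
    refine Submodule.add_mem_sup ⟨_, rfl⟩ ?_
    have h1 := congrArg p (hc' (y - t y))
    simp only [map_sub, htp, sub_zero] at h1
    simp [h1]
  obtain ⟨z, rfl⟩ := LinearMap.range_eq_top.1 hr x
  have := hc' z
  rw [htx, sub_self] at this
  rw [← this, map_zero]

/-- As X is projective, p factors through the cover q, so q inherits purity; having superfluous
kernel, it is then an isomorphism. -/
theorem PureEpi.projective_of_hasProjectiveCover [Module.Projective R X] {p : X →ₗ[R] Y}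
    (hp : PureEpi p) (hY : HasProjectiveCover R (ModuleCat.of R Y)) : Module.Projective R Y := by
  obtain ⟨Q, q, hQ, hq, hs⟩ := hY
  obtain ⟨k, hk⟩ := Module.projective_lifting_property q p hq
  have hpq : PureEpi (Y := Y) q := by
    intro A _ _ hA f
    obtain ⟨g, rfl⟩ := hp A hA f
    exact ⟨k ∘ₗ g, by rw [← LinearMap.comp_assoc, hk]⟩
  exact Module.Projective.of_equiv
    (LinearEquiv.ofBijective q ⟨hpq.injective_of_superfluous hs, hq⟩)

/-- Covers are needed only for quotients of X, so for finitely generated X a semi-perfect ring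
suffices. -/
theorem pureEpiSplits_of_projective [Module.Projective R X]
    (h : ∀ (Y : Type u) [AddCommGroup Y] [Module R Y] (p : X →ₗ[R] Y),
      Function.Surjective p → HasProjectiveCover R (ModuleCat.of R Y)) :
    PureEpiSplits R X := by
  intro Y _ _ p hp
  have := hp.projective_of_hasProjectiveCover (h Y p hp.surjective)
  exact Module.projective_lifting_property p LinearMap.id hp.surjective

end Modules

end PureMinimality

namespace PureMinimality

/-! ### Pure-acyclicity tested by Hom from finitely presented modules -/

section PureAcyclic

variable {R : Type u} [Ring R]

/-- For every finitely presented module `A` the complex `Hom(A, M)` is acyclic. -/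
def HomAcyclic (M : RComplex R) : Prop :=
  ∀ (A : Type u) [AddCommGroup A] [Module R A], Module.FinitePresentation R A →
    ∀ (i : ℤ) (f : A →ₗ[R] M.X (i - 1)), (∀ k, (M.d (i - 1) k).hom ∘ₗ f = 0) →
      ∃ g : A →ₗ[R] M.X i, (M.d i (i - 1)).hom ∘ₗ g = f

theorem HomAcyclic.exists_lift {M : RComplex R} (hM : HomAcyclic M) {A : Type u} [AddCommGroup A]
    [Module R A] (hA : Module.FinitePresentation R A) {i j k : ℤ} (hij : j + 1 = i)
    (hjk : k + 1 = j) (f : A →ₗ[R] M.X j) (hf : (M.d j k).hom ∘ₗ f = 0) :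
    ∃ g : A →ₗ[R] M.X i, (M.d i j).hom ∘ₗ g = f := by
  obtain rfl : j = i - 1 := by omega
  refine hM A hA i f fun l => ?_
  by_cases h : l + 1 = i - 1
  · obtain rfl : l = k := by omega
    exact hf
  · rw [M.shape _ _ h, ModuleCat.hom_zero, LinearMap.zero_comp]

theorem d_hom_d_hom (M : RComplex R) (i j k : ℤ) (x : M.X i) :
    (M.d j k).hom ((M.d i j).hom x) = 0 :=
  congrArg (fun f => f.hom x) (M.d_comp_d i j k)

theorem injective_comp_and_exact_comp {C : Type*} [Category C] [Abelian C] {S : ShortComplex C}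
    (hS : S.ShortExact) (A : C) :
    Function.Injective (fun h : A ⟶ S.X₁ => h ≫ S.f) ∧
      Function.Exact (fun h : A ⟶ S.X₁ => h ≫ S.f) (fun h : A ⟶ S.X₂ => h ≫ S.g) := by
  have := hS.mono_f
  refine ⟨fun a b h => (cancel_mono S.f).1 h, fun h => ⟨fun hh => ?_, ?_⟩⟩
  · exact ⟨hS.exact.lift h hh, hS.exact.lift_f h hh⟩
  · rintro ⟨a, rfl⟩
    simp

/-- Maps A → Z_{i-1}(M) are the maps A → M_{i-1} killed by the differential, so purity of the cycle
sequences is a lifting property. The case A = R recovers acyclicity. -/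
theorem isPureAcyclic_iff {M : RComplex R} : IsPureAcyclic M ↔ HomAcyclic M := by
  constructor
  · rintro ⟨-, h⟩ A _ _ hA i f hf
    obtain ⟨g, hg⟩ := ((h i).2 (ModuleCat.of R A) hA).2.2
      (M.liftCycles (ModuleCat.ofHom f) (i - 1 - 1) (by simp) (by
        ext x
        exact LinearMap.congr_fun (hf _) x))
    change ModuleCat.of R A ⟶ M.X i at g
    have h1 : g ≫ M.d i (i - 1) = ModuleCat.ofHom f := by
      rw [← M.toCycles_i i (i - 1), ← Category.assoc,
        show g ≫ M.toCycles i (i - 1) = _ from hg, M.liftCycles_i]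
    exact ⟨g.hom, congrArg (fun k => k.hom) h1⟩
  · intro h
    have hac : M.Acyclic := by
      intro j
      rw [M.exactAt_iff' (j + 1) j (j - 1) (by simp) (by simp), ShortComplex.moduleCat_exact_iff]
      intro (x : M.X j) (hx : (M.d j (j - 1)).hom x = 0)
      obtain ⟨g, hg⟩ := h.exists_lift (A := R) inferInstance (i := j + 1) (j := j) (k := j - 1) rfl
        (by omega) (LinearMap.toSpanSingleton R _ x) (LinearMap.ext_ring (by simpa using hx))
      refine ⟨g 1, (LinearMap.congr_fun hg 1).trans ?_⟩
      rw [LinearMap.toSpanSingleton_apply, one_smul]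
    have hsurj (i : ℤ) (A : ModuleCat.{u} R) (hA : Module.FinitePresentation R A)
        (f : A ⟶ M.cycles (i - 1)) : ∃ g : A ⟶ M.X i, g ≫ M.toCycles i (i - 1) = f := by
      obtain ⟨g, hg⟩ := h A hA i (f ≫ M.iCycles (i - 1)).hom (fun k => by
        rw [← ModuleCat.hom_comp]
        simp)
      refine ⟨ModuleCat.ofHom g, ?_⟩
      rw [← cancel_mono (M.iCycles (i - 1)), Category.assoc, M.toCycles_i]
      ext x
      exact LinearMap.congr_fun hg x
    have hse (i : ℤ) : (cycleSeq M i).ShortExact := by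
      have h1 : Epi (M.toCycles i (i - 1)) := by
        rw [ModuleCat.epi_iff_surjective]
        intro z
        obtain ⟨g, hg⟩ := hsurj i (ModuleCat.of R R)
          (inferInstanceAs (Module.FinitePresentation R R))
          (ModuleCat.ofHom (LinearMap.toSpanSingleton R _ z))
        refine ⟨g.hom (1 : R), (congrArg (fun k => k.hom (1 : R)) hg).trans ?_⟩
        exact one_smul R z
      have h3 : Mono (cycleSeq M i).f := inferInstanceAs (Mono (M.iCycles i))
      have h2 : (cycleSeq M i).Exact :=
        ShortComplex.exact_of_f_is_kernel _ (KernelFork.IsLimit.ofι' _ _ fun {B} (k : B ⟶ M.X i) hk =>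
          ⟨M.liftCycles k (i - 1) (by simp) (by
            rw [← M.toCycles_i i (i - 1), ← Category.assoc,
              show k ≫ M.toCycles i (i - 1) = 0 from hk, zero_comp]), M.liftCycles_i _ _ _ _⟩)
      exact { exact := h2, mono_f := h3, epi_g := h1 }
    refine ⟨hac, fun i => ⟨hse i, fun A hA => ?_⟩⟩
    obtain ⟨h1, h2⟩ := injective_comp_and_exact_comp (hse i) A
    exact ⟨h1, h2, hsurj i A hA⟩

end PureAcyclic

/-! ### From purity of complexes to degreewise purity -/

namespace Subcomplex

variable {R : Type u} [Ring R] {M : RComplex R} (P : Subcomplex M)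

theorem shortExact_seq : P.seq.ShortExact := by
  apply HomologicalComplex.shortExact_of_degreewise_shortExact
  intro i
  exact
    { exact := (ShortComplex.moduleCat_exact_iff _).2 fun x hx =>
        ⟨⟨x, (Submodule.Quotient.mk_eq_zero (P.carrier i)).1 hx⟩, rfl⟩
      mono_f := (ModuleCat.mono_iff_injective _).2 (P.carrier i).subtype_injective
      epi_g := (ModuleCat.epi_iff_surjective _).2 (P.carrier i).mkQ_surjective }

/-- Test with the disk complex A = A in degrees i and i - 1: chain maps out of it are linear maps
from A to the degree i term. -/
theorem IsPure.pureEpi {P : Subcomplex M} (hP : P.IsPure) (i : ℤ) :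
    PureEpi (P.carrier i).mkQ := by
  intro A _ _ hA f
  have hrel : (ComplexShape.down ℤ).Rel i (i - 1) := by simp
  have hne : i ≠ i - 1 := by omega
  let B := HomologicalComplex.double (𝟙 (ModuleCat.of R A)) hrel
  have hB : IsBoundedFinPres B := by
    refine ⟨⟨i - 1, i, fun k hk => ?_⟩, fun k => ?_⟩
    · exact HomologicalComplex.isZero_double_X _ _ _ (by omega) (by omega)
    · by_cases h0 : k = i
      · subst h0
        exact Module.FinitePresentation.of_equiv
          (HomologicalComplex.doubleXIso₀ (𝟙 (ModuleCat.of R A)) hrel).symm.toLinearEquiv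
      by_cases h1 : k = i - 1
      · subst h1
        exact Module.FinitePresentation.of_equiv
          (HomologicalComplex.doubleXIso₁ (𝟙 (ModuleCat.of R A)) hrel hne).symm.toLinearEquiv
      · have := ModuleCat.subsingleton_of_isZero (HomologicalComplex.isZero_double_X
          (𝟙 (ModuleCat.of R A)) hrel k h0 h1)
        exact Module.FinitePresentation.of_subsingleton (B.X k)
  let f' : ModuleCat.of R A ⟶ P.quotient.X i := ModuleCat.ofHom f
  let φ : B ⟶ P.quotient := HomologicalComplex.mkHomFromDouble hrel hne f'
    (f' ≫ P.quotient.d i (i - 1)) (Category.id_comp _).symm fun k _ => by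
      rw [Category.assoc, P.quotient.d_comp_d, comp_zero]
  obtain ⟨ψ, hψ⟩ := (hP.2 B hB).2.2 φ
  change B ⟶ M at ψ
  change ψ ≫ P.π = φ at hψ
  let e := HomologicalComplex.doubleXIso₀ (𝟙 (ModuleCat.of R A)) hrel
  refine ⟨(e.inv ≫ ψ.f i).hom, ?_⟩
  have h1 : ψ.f i ≫ P.π.f i = e.hom ≫ f' := by
    rw [← HomologicalComplex.comp_f]
    exact (congrArg (fun k => k.f i) hψ).trans (HomologicalComplex.mkHomFromDouble_f₀ ..)
  have h2 : (e.inv ≫ ψ.f i) ≫ P.π.f i = f' := by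
    rw [Category.assoc, h1, Iso.inv_hom_id_assoc]
  exact congrArg (fun k => k.hom) h2

end Subcomplex

end PureMinimality

namespace PureMinimality

/-! ### Directed unions and preimages of pure submodules -/

section Modules

variable {R : Type u} [Ring R] {X : Type u} [AddCommGroup X] [Module R X]

theorem exists_range_le_of_directed {A : Type*} [AddCommGroup A] [Module R A] [Module.Finite R A]
    {κ : Type*} [Nonempty κ] {N : κ → Submodule R X} (hN : Directed (· ≤ ·) N) (f : A →ₗ[R] X)
    (hf : LinearMap.range f ≤ ⨆ k, N k) : ∃ k, LinearMap.range f ≤ N k := by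
  have hfg : (LinearMap.range f).FG := by
    rw [← Submodule.map_top]
    exact Module.Finite.fg_top.map f
  obtain ⟨-, ⟨k, rfl⟩, hk⟩ := (CompleteLattice.isCompactElement_iff_le_of_directed_sSup_le _ _).1
    ((Submodule.fg_iff_compact _).1 hfg) (Set.range N) (Set.range_nonempty N)
    hN.directedOn_range (by rwa [sSup_range])
  exact ⟨k, hk⟩

/-- Present A as R^n/K with K finitely generated and lift to R^n → X. The image of K lies in the
union, hence in a single N k, where purity applies. -/
theorem pureEpi_mkQ_iSup {κ : Type*} [Nonempty κ] {N : κ → Submodule R X}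
    (hN : Directed (· ≤ ·) N) (hp : ∀ k, PureEpi (N k).mkQ) : PureEpi (⨆ k, N k).mkQ := by
  intro A _ _ hA f
  obtain ⟨n, K, e, hK⟩ := Module.FinitePresentation.exists_fin R A
  obtain ⟨h, hh⟩ := Module.projective_lifting_property (⨆ k, N k).mkQ
    (f ∘ₗ e.symm.toLinearMap ∘ₗ K.mkQ) (Submodule.mkQ_surjective _)
  have : Module.Finite R K := Module.Finite.iff_fg.2 hK
  obtain ⟨k, hk⟩ := exists_range_le_of_directed hN (h ∘ₗ K.subtype) (by
    rintro - ⟨x, rfl⟩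
    have h0 : K.mkQ x = 0 := (Submodule.Quotient.mk_eq_zero K).2 x.2
    have h1 : (⨆ k, N k).mkQ (h x) = f (e.symm (K.mkQ x)) := LinearMap.congr_fun hh x
    rw [h0, map_zero, map_zero] at h1
    exact (Submodule.Quotient.mk_eq_zero _).1 h1)
  obtain ⟨g, hg⟩ := hp k A hA (K.liftQ ((N k).mkQ ∘ₗ h) (fun x hx =>
    (Submodule.Quotient.mk_eq_zero _).2 (hk ⟨⟨x, hx⟩, rfl⟩)) ∘ₗ e.toLinearMap)
  refine ⟨g, ?_⟩
  ext a
  obtain ⟨b, rfl⟩ := e.symm.surjective a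
  obtain ⟨c, rfl⟩ := K.mkQ_surjective b
  have h1 : (⨆ k, N k).mkQ (h c) = f (e.symm (K.mkQ c)) := LinearMap.congr_fun hh c
  have h2 : (N k).mkQ (g (e.symm (K.mkQ c))) = (N k).mkQ (h c) := by
    refine (LinearMap.congr_fun hg _).trans ?_
    rw [LinearMap.comp_apply, LinearEquiv.coe_coe, e.apply_symm_apply]
    rfl
  change (⨆ k, N k).mkQ _ = _
  rw [← h1]
  exact (Submodule.Quotient.eq _).2 (le_iSup N k ((Submodule.Quotient.eq _).1 h2))

theorem pureEpi_mkQ_comap {N : Submodule R X} {Q : Submodule R (X ⧸ N)} (hN : PureEpi N.mkQ)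
    (hQ : PureEpi Q.mkQ) : PureEpi (Q.comap N.mkQ).mkQ := by
  intro A _ _ hA f
  obtain ⟨g, hg⟩ := hQ A hA ((Q.comap N.mkQ).mapQ Q N.mkQ le_rfl ∘ₗ f)
  obtain ⟨h, rfl⟩ := hN A hA g
  refine ⟨h, LinearMap.ext fun a => ?_⟩
  have hm : LinearMap.ker ((Q.comap N.mkQ).mapQ Q N.mkQ le_rfl) = ⊥ := by
    rw [Submodule.ker_mapQ]
    exact Submodule.mkQ_map_self _
  exact LinearMap.ker_eq_bot.1 hm (LinearMap.congr_fun hg a)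

end Modules

/-! ### The class of pure-acyclic pure subcomplexes, and Zorn's lemma -/

namespace Subcomplex

variable {R : Type u} [Ring R] {M : RComplex R} {P : Subcomplex M}

theorem homAcyclic_toComplex_iff : HomAcyclic P.toComplex ↔
    ∀ (A : Type u) [AddCommGroup A] [Module R A], Module.FinitePresentation R A →
      ∀ (i : ℤ) (f : A →ₗ[R] M.X (i - 1)), (∀ x, f x ∈ P.carrier (i - 1)) →
        (∀ k, (M.d (i - 1) k).hom ∘ₗ f = 0) →
        ∃ g : A →ₗ[R] M.X i, (∀ x, g x ∈ P.carrier i) ∧ (M.d i (i - 1)).hom ∘ₗ g = f := by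
  constructor
  · intro h A _ _ hA i f hfP hf
    obtain ⟨g, hg⟩ := h A hA i (LinearMap.codRestrict (P.carrier (i - 1)) f hfP) fun k => by
      ext x
      exact Subtype.ext (LinearMap.congr_fun (hf k) x)
    refine ⟨(P.carrier i).subtype ∘ₗ g, fun x => (g x).2, ?_⟩
    ext x
    exact congrArg Subtype.val (LinearMap.congr_fun hg x)
  · intro h A _ _ hA i f hf
    obtain ⟨g, hgP, hg⟩ := h A hA i ((P.carrier (i - 1)).subtype ∘ₗ f) (fun x => (f x).2)
      fun k => by
        ext x
        exact congrArg Subtype.val (LinearMap.congr_fun (hf k) x)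
    refine ⟨LinearMap.codRestrict (P.carrier i) g hgP, ?_⟩
    ext x
    exact Subtype.ext (LinearMap.congr_fun hg x)

/-- A degreewise pure subcomplex that is pure-acyclic is pure. -/
theorem isPure_of_pureEpi (hP : ∀ i, PureEpi (P.carrier i).mkQ) (hac : HomAcyclic P.toComplex) :
    P.IsPure := by
  refine ⟨P.shortExact_seq, fun A hA => ?_⟩
  obtain ⟨h1, h2⟩ := injective_comp_and_exact_comp P.shortExact_seq A
  refine ⟨h1, h2, fun (f : A ⟶ P.quotient) => ?_⟩
  obtain ⟨⟨a, b, hab⟩, hfp⟩ := hA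
  rw [homAcyclic_toComplex_iff] at hac
  -- The lift is built upwards from the lowest degree of A; `g` is a total family, constrained only
  -- in degrees below a + n.
  have key (n : ℕ) : ∃ g : ∀ i, A.X i →ₗ[R] M.X i, ∀ i < a + n,
      (P.carrier i).mkQ ∘ₗ g i = (f.f i).hom ∧
        ∀ j, (M.d i j).hom ∘ₗ g i = g j ∘ₗ (A.d i j).hom := by
    induction n with
    | zero =>
      refine ⟨fun _ => 0, fun i hi => ?_⟩
      have := ModuleCat.subsingleton_of_isZero (hab i (.inl (by simpa using hi)))
      exact ⟨LinearMap.ext fun x => by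
        rw [Subsingleton.elim x 0, map_zero]
        exact (map_zero (f.f i).hom).symm, fun j => by simp⟩
    | succ n ih =>
      obtain ⟨g, hg⟩ := ih
      obtain ⟨i, hi⟩ : ∃ i, i = a + (n : ℤ) := ⟨_, rfl⟩
      rw [← hi] at hg
      obtain ⟨g', hg'⟩ := hP i (A.X i) (hfp i) (f.f i).hom
      have hq (x : A.X i) : (P.carrier i).mkQ (g' x) = (f.f i).hom x := LinearMap.congr_fun hg' x
      have hq1 (x : A.X (i - 1)) : (P.carrier (i - 1)).mkQ (g (i - 1) x) = (f.f (i - 1)).hom x :=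
        LinearMap.congr_fun (hg (i - 1) (by omega)).1 x
      have hf (x : A.X i) : (P.quotient.d i (i - 1)).hom ((f.f i).hom x) =
          (f.f (i - 1)).hom ((A.d i (i - 1)).hom x) :=
        congrArg (fun k => k.hom x) (f.comm i (i - 1))
      -- The failure of g' to commute with the differentials is a cycle with values in P, hence the
      -- boundary of some k into P; g' - k commutes and still lifts f.
      obtain ⟨k, hkP, hk⟩ := hac (A.X i) (hfp i) i
        ((M.d i (i - 1)).hom ∘ₗ g' - g (i - 1) ∘ₗ (A.d i (i - 1)).hom)
        (fun x => by
          rw [← Submodule.Quotient.mk_eq_zero]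
          change (P.carrier (i - 1)).mkQ ((M.d i (i - 1)).hom (g' x) -
            g (i - 1) ((A.d i (i - 1)).hom x)) = 0
          rw [map_sub, hq1]
          exact sub_eq_zero.2 ((congrArg (P.quotient.d i (i - 1)).hom (hq x)).trans (hf x)))
        (fun k => by
          ext x
          change (M.d (i - 1) k).hom ((M.d i (i - 1)).hom (g' x) -
            g (i - 1) ((A.d i (i - 1)).hom x)) = 0
          have h3 : (M.d (i - 1) k).hom (g (i - 1) ((A.d i (i - 1)).hom x)) =
            g k ((A.d (i - 1) k).hom ((A.d i (i - 1)).hom x)) :=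
            LinearMap.congr_fun ((hg (i - 1) (by omega)).2 k) _
          rw [map_sub, d_hom_d_hom, h3, d_hom_d_hom, map_zero, sub_zero])
      have hshape (l j : ℤ) (hlj : j + 1 ≠ l) (u : A.X l →ₗ[R] M.X l) (v : A.X j →ₗ[R] M.X j) :
          (M.d l j).hom ∘ₗ u = v ∘ₗ (A.d l j).hom := by
        rw [M.shape l j hlj, A.shape l j hlj]
        simp
      refine ⟨Function.update g i (g' - k), fun l hl => ?_⟩
      by_cases hli : l = i
      · subst hli
        rw [Function.update_self]
        refine ⟨?_, fun j => ?_⟩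
        · ext x
          have hk0 : (P.carrier l).mkQ (k x) = 0 := (Submodule.Quotient.mk_eq_zero _).2 (hkP x)
          change (P.carrier l).mkQ (g' x - k x) = _
          rw [map_sub, hk0, sub_zero]
          exact hq x
        · by_cases hj : j + 1 = l
          · obtain rfl : j = l - 1 := by omega
            rw [Function.update_of_ne (by omega), LinearMap.comp_sub, hk]
            abel
          · exact hshape _ _ hj _ _
      · rw [Function.update_of_ne hli]
        obtain ⟨h4, h5⟩ := hg l (by push_cast at hl; omega)
        refine ⟨h4, fun j => ?_⟩
        by_cases hj : j + 1 = l
        · rw [Function.update_of_ne (by push_cast at hl; omega)]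
          exact h5 j
        · exact hshape _ _ hj _ _
  -- This many steps cover all degrees up to b. If b + 1 < a, `toNat` gives 0 and A is zero
  -- everywhere.
  obtain ⟨g, hg⟩ := key (b + 1 - a).toNat
  have hz (i : ℤ) (hi : ¬ i < a + ((b + 1 - a).toNat : ℤ)) : Subsingleton (A.X i) :=
    ModuleCat.subsingleton_of_isZero (hab i (by omega))
  let φ : A ⟶ M :=
    { f := fun i => ModuleCat.ofHom (g i)
      comm' := fun i j _ => by
        ext x
        by_cases hi : i < a + ((b + 1 - a).toNat : ℤ)
        · exact LinearMap.congr_fun ((hg i hi).2 j) x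
        · have := hz i hi
          rw [Subsingleton.elim x 0, map_zero, map_zero] }
  refine ⟨φ, ?_⟩
  change φ ≫ P.π = f
  ext i x
  by_cases hi : i < a + ((b + 1 - a).toNat : ℤ)
  · exact LinearMap.congr_fun (hg i hi).1 x
  · have := hz i hi
    rw [Subsingleton.elim x 0, map_zero, map_zero]

instance : PartialOrder (Subcomplex M) :=
  PartialOrder.lift carrier fun _ _ => Subcomplex.ext

/-- The union of a family of subcomplexes (as a supremum of submodules). -/
def iSup {κ : Type*} (Q : κ → Subcomplex M) : Subcomplex M where
  carrier i := ⨆ k, (Q k).carrier i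
  d_mem i j x hx := by
    have h : (⨆ k, (Q k).carrier i) ≤ (⨆ k, (Q k).carrier j).comap (M.d i j).hom :=
      iSup_le fun k y hy => Submodule.mem_iSup_of_mem k ((Q k).d_mem i j y hy)
    exact h hx

/-- The preimage in `M` of a subcomplex of `M/P`. -/
def comap (P : Subcomplex M) (Q : Subcomplex P.quotient) : Subcomplex M where
  carrier i := (Q.carrier i).comap (P.carrier i).mkQ
  d_mem i j _ hx := Q.d_mem i j _ hx

/-- The pure-acyclic pure subcomplexes, described without the category of complexes. -/
def IsDegreewisePureAcyclic (P : Subcomplex M) : Prop :=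
  (∀ i, PureEpi (P.carrier i).mkQ) ∧ HomAcyclic P.toComplex

theorem isDegreewisePureAcyclic_iff :
    P.IsDegreewisePureAcyclic ↔ P.IsPure ∧ IsPureAcyclic P.toComplex := by
  rw [isPureAcyclic_iff]
  exact ⟨fun h => ⟨isPure_of_pureEpi h.1 h.2, h.2⟩, fun h => ⟨h.1.pureEpi, h.2⟩⟩

theorem isDegreewisePureAcyclic_iSup {κ : Type*} [Nonempty κ] {Q : κ → Subcomplex M}
    (hd : Directed (· ≤ ·) Q) (hQ : ∀ k, (Q k).IsDegreewisePureAcyclic) :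
    (iSup Q).IsDegreewisePureAcyclic := by
  have hdi (i : ℤ) : Directed (· ≤ ·) fun k => (Q k).carrier i := fun a b => by
    obtain ⟨c, hac, hbc⟩ := hd a b
    exact ⟨c, hac i, hbc i⟩
  refine ⟨fun i => pureEpi_mkQ_iSup (hdi i) fun k => (hQ k).1 i, ?_⟩
  rw [homAcyclic_toComplex_iff]
  intro A _ _ hA i f hfP hf
  obtain ⟨k, hk⟩ := exists_range_le_of_directed (hdi (i - 1)) f (by
    rintro - ⟨x, rfl⟩
    exact hfP x)
  obtain ⟨g, hgP, hg⟩ := homAcyclic_toComplex_iff.1 (hQ k).2 A hA i f (fun x => hk ⟨x, rfl⟩) hf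
  exact ⟨g, fun x => Submodule.mem_iSup_of_mem k (hgP x), hg⟩

/-- Solve modulo P inside Q, lift the solution to M by purity of P, and remove the remaining error,
a cycle in P, using acyclicity of Hom(A, P). -/
theorem isDegreewisePureAcyclic_comap (hP : P.IsDegreewisePureAcyclic)
    {Q : Subcomplex P.quotient} (hQ : Q.IsDegreewisePureAcyclic) :
    (P.comap Q).IsDegreewisePureAcyclic := by
  constructor
  · exact fun i => pureEpi_mkQ_comap (hP.1 i) (hQ.1 i)
  · rw [homAcyclic_toComplex_iff]
    intro A _ _ hA i f hfP hf
    obtain ⟨g, hgQ, hg⟩ := homAcyclic_toComplex_iff.1 hQ.2 A hA i ((P.carrier (i - 1)).mkQ ∘ₗ f)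
      hfP (fun k => by
        ext x
        exact congrArg (P.carrier k).mkQ (LinearMap.congr_fun (hf k) x))
    obtain ⟨h, rfl⟩ := hP.1 i A hA g
    obtain ⟨k, hkP, hk⟩ := homAcyclic_toComplex_iff.1 hP.2 A hA i
      (f - (M.d i (i - 1)).hom ∘ₗ h) (fun x => by
        refine (Submodule.Quotient.eq _).1 ?_
        exact (LinearMap.congr_fun hg x).symm) (fun k => by
          ext x
          have h1 : (M.d (i - 1) k).hom (f x) = 0 := LinearMap.congr_fun (hf k) x
          change (M.d (i - 1) k).hom (f x - (M.d i (i - 1)).hom (h x)) = 0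
          rw [map_sub, h1, d_hom_d_hom, sub_zero])
    refine ⟨h + k, fun x => ?_, by rw [LinearMap.comp_add, hk, add_sub_cancel]⟩
    refine Submodule.add_mem _ (hgQ x) ?_
    have h0 : (P.carrier i).mkQ (k x) = 0 := (Submodule.Quotient.mk_eq_zero _).2 (hkP x)
    change (P.carrier i).mkQ (k x) ∈ Q.carrier i
    rw [h0]
    exact Submodule.zero_mem _

/-- Every complex has a pure-acyclic pure subcomplex with pure-minimal quotient. -/
theorem exists_isPureMinimal_quotient (M : RComplex R) : ∃ P : Subcomplex M, P.IsPure ∧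
    IsPureAcyclic P.toComplex ∧ IsPureMinimal P.quotient := by
  have hbot : (⟨fun _ => ⊥, fun i j x hx => by simp_all⟩ : Subcomplex M).IsDegreewisePureAcyclic := by
    refine ⟨fun i => ?_, ?_⟩
    · exact PureEpi.of_section (s := (Submodule.quotEquivOfEqBot ⊥ rfl).toLinearMap)
        (by ext; simp)
    · rw [homAcyclic_toComplex_iff]
      intro A _ _ _ i f hfP _
      refine ⟨0, fun _ => Submodule.zero_mem _, ?_⟩
      ext x
      exact (map_zero (M.d i (i - 1)).hom).trans ((Submodule.mem_bot R).1 (hfP x)).symm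
  obtain ⟨P, -, hP⟩ := zorn_le_nonempty₀ {P : Subcomplex M | P.IsDegreewisePureAcyclic}
    (fun c hc hchain y hy => by
      have : Nonempty c := ⟨⟨y, hy⟩⟩
      exact ⟨iSup fun Q : c => Q.1, isDegreewisePureAcyclic_iSup hchain.directed fun Q => hc Q.2,
        fun z hz i => le_iSup (fun Q : c => Q.1.carrier i) ⟨z, hz⟩⟩) _ hbot
  obtain ⟨h1, h2⟩ := isDegreewisePureAcyclic_iff.1 hP.prop
  refine ⟨P, h1, h2, fun Q hQ hQac i => ?_⟩
  -- The preimage of Q contains P and belongs to the class, so maximality forces Q = 0.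
  have h3 := isDegreewisePureAcyclic_comap hP.prop (isDegreewisePureAcyclic_iff.2 ⟨hQ, hQac⟩)
  have h4 : P.comap Q ≤ P := hP.le_of_ge h3 fun i x hx => by
    have h0 : (P.carrier i).mkQ x = 0 := (Submodule.Quotient.mk_eq_zero _).2 hx
    change (P.carrier i).mkQ x ∈ Q.carrier i
    rw [h0]
    exact Submodule.zero_mem _
  rw [eq_bot_iff]
  intro y hy
  obtain ⟨x, rfl⟩ := (P.carrier i).mkQ_surjective y
  exact (Submodule.Quotient.mk_eq_zero _).2 (h4 i hy)

end Subcomplex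

/-! ### Contractions and splitting -/

/-- A pure-acyclic complex whose modules split all pure epimorphisms is contractible. -/
theorem HomAcyclic.isContractible {R : Type u} [Ring R] {M : RComplex R} (hM : HomAcyclic M)
    (hs : ∀ i, PureEpiSplits R (M.X i)) : IsContractible M := by
  have key (i j : ℤ) (hij : j + 1 = i) :
      ∃ s : LinearMap.ker (M.d j (j - 1)).hom →ₗ[R] M.X i, ∀ x, (M.d i j).hom (s x) = x := by
    let p := LinearMap.codRestrict (LinearMap.ker (M.d j (j - 1)).hom) (M.d i j).hom
      fun x => d_hom_d_hom M i j (j - 1) x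
    obtain ⟨s, hs⟩ := hs i _ p (by
      intro A _ _ hA f
      obtain ⟨g, hg⟩ := hM.exists_lift hA hij (sub_add_cancel j 1) (Submodule.subtype _ ∘ₗ f)
        (LinearMap.ext fun x => (f x).2)
      exact ⟨g, LinearMap.ext fun x => Subtype.ext (LinearMap.congr_fun hg x)⟩)
    exact ⟨s, fun x => congrArg Subtype.val (LinearMap.congr_fun hs x)⟩
  choose s hs using key
  -- The contraction is t(x) = s(x - s(∂x)), with s the sections of the maps onto cycles. Then ∂t(x)
  -- = x - s(∂x) and t(∂x) = s(∂x), which add up to x.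
  have key2 (i j : ℤ) (hij : j + 1 = i) : ∃ t : M.X j →ₗ[R] M.X i, ∀ x,
      ∃ (h1 : (M.d j (j - 1)).hom x ∈ LinearMap.ker (M.d (j - 1) (j - 1 - 1)).hom)
        (h2 : x - s j (j - 1) (by omega) ⟨_, h1⟩ ∈ LinearMap.ker (M.d j (j - 1)).hom),
        t x = s i j hij ⟨_, h2⟩ := by
    let u : M.X j →ₗ[R] M.X j := LinearMap.id - s j (j - 1) (by omega) ∘ₗ
      LinearMap.codRestrict _ (M.d j (j - 1)).hom fun x => d_hom_d_hom M j (j - 1) (j - 1 - 1) x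
    have hu (x : M.X j) : u x ∈ LinearMap.ker (M.d j (j - 1)).hom := by
      change (M.d j (j - 1)).hom (x - s j (j - 1) (by omega) ⟨_, d_hom_d_hom M _ _ _ x⟩) = 0
      rw [map_sub, hs, sub_self]
    exact ⟨s i j hij ∘ₗ LinearMap.codRestrict _ u hu,
      fun x => ⟨d_hom_d_hom M _ _ _ x, hu x, rfl⟩⟩
  choose t h1 h2 ht using key2
  let t' (i j : ℤ) (hij : (ComplexShape.down ℤ).Rel j i) : M.X i ⟶ M.X j :=
    ModuleCat.ofHom (t j i hij)
  have hid : 𝟙 M = Homotopy.nullHomotopicMap' t' := by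
    ext1 j
    rw [Homotopy.nullHomotopicMap'_f (k₂ := j + 1) (k₁ := j) (k₀ := j - 1) (by simp) (by simp)]
    ext x
    have e1 : (M.d (j + 1) j).hom (t (j + 1) j rfl x) = x - s j (j - 1) (by omega) ⟨_, h1 _ _ rfl x⟩ := by
      rw [ht, hs]
    have e2 : t j (j - 1) (by omega) ((M.d j (j - 1)).hom x) =
        s j (j - 1) (by omega) ⟨_, h1 _ _ rfl x⟩ := by
      rw [ht]
      congr 2
      have : (⟨_, h1 j (j - 1) (by omega) ((M.d j (j - 1)).hom x)⟩ :
          LinearMap.ker (M.d (j - 1 - 1) (j - 1 - 1 - 1)).hom) = 0 :=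
        Subtype.ext (d_hom_d_hom M _ _ _ x)
      rw [this, map_zero, sub_zero]
    change x = t j (j - 1) _ ((M.d j (j - 1)).hom x) + (M.d (j + 1) j).hom (t (j + 1) j _ x)
    rw [e1, e2, add_sub_cancel]
  exact ⟨(Homotopy.ofEq hid).trans (Homotopy.nullHomotopy' _)⟩

/-- A degreewise split subcomplex that is contractible is a direct summand. -/
theorem Subcomplex.nonempty_splitting {R : Type u} [Ring R] {M : RComplex R} {P : Subcomplex M}
    (hc : IsContractible P.toComplex)
    (hr : ∀ i, ∃ r : M.X i →ₗ[R] P.carrier i, r ∘ₗ (P.carrier i).subtype = LinearMap.id) :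
    Nonempty P.seq.Splitting := by
  obtain ⟨H⟩ := hc
  choose r hr using hr
  let r' (i : ℤ) : M.X i ⟶ P.toComplex.X i := ModuleCat.ofHom (r i)
  have hr' (i : ℤ) : P.ι.f i ≫ r' i = 𝟙 _ := by
    ext x
    exact LinearMap.congr_fun (hr i) x
  have hid : Homotopy.nullHomotopicMap H.hom = 𝟙 P.toComplex := by
    ext1 i
    rw [H.comm i]
    simp [Homotopy.nullHomotopicMap]
  -- The r i need not commute with the differentials, but ∂(Hr) + (Hr)∂ always does, and it
  -- restricts to ∂H + H∂ = id on P.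
  refine ⟨ShortComplex.Splitting.ofExactOfRetraction P.seq P.shortExact_seq.exact
    (Homotopy.nullHomotopicMap fun i j => r' i ≫ H.hom i j) ?_ P.shortExact_seq.epi_g⟩
  refine (Homotopy.comp_nullHomotopicMap P.ι _).trans ?_
  refine (congrArg Homotopy.nullHomotopicMap (funext₂ fun i j => ?_)).trans hid
  exact (Category.assoc (P.ι.f i) (r' i) (H.hom i j)).symm.trans
    ((congrArg (· ≫ H.hom i j) (hr' i)).trans (Category.id_comp _))

theorem pureEpiSplits_of_cases {R : Type u} [Ring R] (M : RComplex R)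
    (hRM : (IsNoetherianRing R ∧ ∀ i : ℤ, Module.Injective R (M.X i)) ∨
      (IsLeftPerfect R ∧ ∀ i : ℤ, Module.Projective R (M.X i)) ∨
      (IsSemiPerfect R ∧ ∀ i : ℤ, Module.Finite R (M.X i) ∧ Module.Projective R (M.X i)) ∨
      (IsNoetherianRing R ∧
        ∀ i : ℤ, Module.Finite R (M.X i) ∧ Module.Projective R (M.X i))) (i : ℤ) :
    PureEpiSplits R (M.X i) := by
  rcases hRM with ⟨hR, hM⟩ | ⟨hR, hM⟩ | ⟨hR, hM⟩ | ⟨hR, hM⟩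
  · exact pureEpiSplits_of_injective (hM i)
  · have := hM i
    exact pureEpiSplits_of_projective fun Y _ _ _ _ => hR _
  · obtain ⟨_, _⟩ := hM i
    exact pureEpiSplits_of_projective fun Y _ _ p hp =>
      hR _ (Module.Finite.of_surjective p hp)
  · have := (hM i).1
    exact pureEpiSplits_of_finite

end PureMinimality

theorem mainTheorem8 {R : Type u} [Ring R] (M : PureMinimality.RComplex R)
    (hRM :
      -- (a) left noetherian ring, complex of injective modules
      (IsNoetherianRing R ∧ ∀ i : ℤ, Module.Injective R (M.X i)) ∨
      -- (b) left perfect ring, complex of projective modules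
      (PureMinimality.IsLeftPerfect R ∧ ∀ i : ℤ, Module.Projective R (M.X i)) ∨
      -- (c) semi-perfect ring, complex of finitely generated projective modules
      (PureMinimality.IsSemiPerfect R ∧
        ∀ i : ℤ, Module.Finite R (M.X i) ∧ Module.Projective R (M.X i)) ∨
      -- (d) left noetherian ring, complex of finitely generated projective modules
      (IsNoetherianRing R ∧
        ∀ i : ℤ, Module.Finite R (M.X i) ∧ Module.Projective R (M.X i))) :
    -- there is a pure-acyclic pure subcomplex with pure-minimal quotient
    (∃ P : PureMinimality.Subcomplex M, P.IsPure ∧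
      PureMinimality.IsPureAcyclic P.toComplex ∧
      PureMinimality.IsPureMinimal P.quotient) ∧
    -- and for every such subcomplex the canonical sequence splits, with contractible kernel
    (∀ P : PureMinimality.Subcomplex M, P.IsPure →
      PureMinimality.IsPureAcyclic P.toComplex →
      PureMinimality.IsPureMinimal P.quotient →
        Nonempty P.seq.Splitting ∧
        (∃ e : M ≅ P.toComplex ⊞ P.quotient,
          P.ι ≫ e.hom = biprod.inl ∧ e.hom ≫ biprod.snd = P.π) ∧
        PureMinimality.IsContractible P.toComplex) := by
  have hs := PureMinimality.pureEpiSplits_of_cases M hRM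
  refine ⟨PureMinimality.Subcomplex.exists_isPureMinimal_quotient M, fun P hP hac _ => ?_⟩
  have hr (i : ℤ) := (hs i).exists_retraction (hP.pureEpi i)
  have hc : PureMinimality.IsContractible P.toComplex :=
    (PureMinimality.isPureAcyclic_iff.1 hac).isContractible fun i => by
      obtain ⟨r, hr⟩ := hr i
      exact (hs i).of_retract hr
  obtain ⟨σ⟩ := PureMinimality.Subcomplex.nonempty_splitting hc hr
  refine ⟨⟨σ⟩, ⟨σ.isoBinaryBiproduct, ?_, biprod.lift_snd _ _⟩, hc⟩
  refine biprod.hom_ext _ _ ?_ ?_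
  · rw [Category.assoc, biprod.inl_fst]
    exact (congrArg (P.ι ≫ ·) (biprod.lift_fst σ.r P.π)).trans σ.f_r
  · rw [Category.assoc, biprod.inl_snd]
    exact (congrArg (P.ι ≫ ·) (biprod.lift_snd σ.r P.π)).trans P.seq.zero
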